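/- **Setting.** Let $d\ge 4$, $\eta=\frac{d-1}{4}$, and for real momenta write $\vec q^{\,2\eta}:=\sum_i|q_i|^{2\eta}$. Consider the melonic sector of the quartic $U(1)^d$ tensorial group field theory with coupling $\lambda$, mass parameter $M=m^{2\eta}$ and sharp cut-off $\Lambda$, in the deep UV (continuum) limit, where sums over $\mathbb Z^{d-1}$ are replaced by integrals over $\mathbb R^{d-1}$. The propagator is $$C(\vec q)=\frac{\Theta(\Lambda^{2\eta}-\vec q^{\,2\eta})}{\vec q^{\,2\eta}+M},\qquad \Theta(0)=0 .$$ A melonic 1PI two-point graph of colour $c\in\{1,\dots,d\}$ consists of one external vertex of colour $c$ and one loop line, on which a finite (possibly empty) sequence of melonic 1PI two-point graphs of arbitrary colours $c_1,\dots,c_r$ is inserted. Its amplitude at external momentum $p$ is $$A(p)=\int_{\mathbb R^{d},\ q_c=p} C(\vec q)^{\,r+1}\prod_{j=1}^r A_j(q_{c_j})\,d^{d-1}q_\perp ,$$ and a graph with $V$ vertices has the weight $(-2\lambda)^V$. Let $\tau_c(p)$ be the sum over the graphs of colour $c$ (a formal power series in $\lambda$), and let $\tau'(0)$ be the derivative of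 $\tau_1$ with respect to $|p|^{2\eta}$ at $p=0$. This derivative is computed graph by graph with the Leibniz rule and $\Theta'=\delta$, each product of $\delta$ with powers of $\Theta$ of the same argument being evaluated with $\Theta(0)=0$. Thus the boundary term in the derivative of $A$ is $$-(r+1)\,\Theta(0)^r\int \delta(\Lambda^{2\eta}-\vec q^{\,2\eta})\,\frac{\prod_j A_j(q_{c_j})}{(\vec q^{\,2\eta}+M)^{r+1}}\,d^{d-1}q_\perp ,$$ which vanishes unless $r=0$. This is the convention for which the boundary contribution is $$\mathcal L\,\partial\tau=\frac{\iota(d)}{1+\bar m^{2\eta}},\qquad \bar m^{2\eta}:=M\Lambda^{-2\eta},\qquad \iota(d):=\int_{\mathbb R^{d-1}}\delta(1-\vec x^{\,2\eta})\,d^{d-1}x .$$ Here $\int \delta(r-\vec x^{\,2\eta})f(\vec x)\,d^{d-1}x:=\frac{d}{dr}\int_{\vec x^{\,2\eta}\le r}f\,d^{d-1}x$. Let $G(\vec q)$ be the sum of all dressed lines of momentum $\vec q$ (a line carrying a sequence of inserted two-point graphs), $\mathcal L=\int_{q_1=0}G(\vec q)^2\,d^{d-1}q_\perp$, and $$\Gamma^{(2)}=M-\sum_{c=1}^d\tau_c(0),\qquad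 Z_{\rm eff}=1-\tau'(0),\qquad \gamma^{(4)}=4\lambda\sum_{j\ge0}(-2\lambda\mathcal L)^j .$$ These are respectively the two-point function at zero momentum, its derivative with respect to $p_1^{2\eta}$ at zero momentum, and the zero-momenta 1PI four-point function, given by the sum over chains of vertices. Let $U$ be a connected open set of parameters $(\Lambda,\lambda,M)$ with $\Lambda>0$ that contains a Gaussian point $(\Lambda_0,0,M_0)$ with $M_0>0$. Suppose that $\Gamma^{(2)},Z_{\rm eff},\gamma^{(4)}$ are real-analytic functions on $U$ which, near $\lambda=0$ at every point $(\Lambda,0,M)\in U$ with $M>0$, are the sums of the above perturbative series in $\lambda$. Let $\beta,\beta_m,\gamma:U\to\mathbb R$ satisfy on $U$ the Callan–Symanzik equations $$\Big(\Lambda\frac{\partial}{\partial\Lambda}+\beta\frac{\partial}{\partial\lambda}+\beta_m\frac{\partial}{\partial M}-\frac N2\gamma\Big)F=0$$ for $F=\Gamma^{(2)}$ and $F=Z_{\rm eff}$ with $N=2$, and for $F=\gamma^{(4)}$ with $N=4$. Define $\beta_{\bar m}$ by $\Lambda^{2\eta}\beta_{\bar m}=\beta_m-2\eta M$. **Proposition.**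 Let $(\Lambda,\lambda,M)\in U$ be a point such that $(\lambda,\bar m^{2\eta})$ lies in the connected component of the Gaussian fixed point $(0,0)$ in the complement of the singular line $1+\bar m^{2\eta}-2\lambda\,\iota(d)=0$, with $\bar m^{2\eta}\neq-1$ and $Z_{\rm eff}\ne0$. Then at this point $$\beta=\gamma\lambda\left(1-\frac{2\lambda\,\iota(d)}{1+\bar m^{2\eta}}\right)+\frac{2\lambda^2\iota(d)}{(1+\bar m^{2\eta})^2}\,\beta_{\bar m}.$$ -/

import Mathlib

open MeasureTheory Filter Topology

noncomputable section

namespace MelonicTGFT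

/-! The rank of the tensors is `d = n + 1`.  A coupling space point is a triple `(Λ, l, M)` with
`Λ` the cut-off, `l` the quartic coupling and `M` the mass parameter `m ^ (2η)`. -/

/-- The exponent `η = (d - 1) / 4` of the just-renormalizable model of rank `d = n + 1`. -/
def eta (n : ℕ) : ℝ := (n : ℝ) / 4

/-- `∑ i, |q i| ^ (2η)`, for a momentum with any number `k` of components. -/
def kin (n : ℕ) {k : ℕ} (q : Fin k → ℝ) : ℝ := ∑ i, |q i| ^ (2 * eta n)

/-- The Heaviside function, with the convention `Θ(0) = 0`. -/
def heaviside (x : ℝ) : ℝ := if 0 < x then 1 else 0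

/-- The sharply cut-off propagator `Θ(Λ ^ (2η) - q ^ (2η)) / (q ^ (2η) + M)`. -/
def propagator (n : ℕ) (Λ M : ℝ) (q : Fin (n + 1) → ℝ) : ℝ :=
  heaviside (Λ ^ (2 * eta n) - kin n q) / (kin n q + M)

/-- The integral of `f` against the Dirac distribution `δ(r - q ^ (2η))` over `ℝ ^ (d - 1)`, as the
derivative of the integral of `f` over `q ^ (2η) ≤ r` with respect to `r`. -/
def deltaIntegral (n : ℕ) (r : ℝ) (f : (Fin n → ℝ) → ℝ) : ℝ :=
  deriv (fun ρ : ℝ => ∫ k in {k : Fin n → ℝ | kin n k ≤ ρ}, f k) r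

/-- `ι(d)`, the integral of `δ(1 - x ^ (2η))` over `ℝ ^ (d - 1)`; by parity this is
`2 ^ (d - 1)` times the integral over the positive orthant. -/
def iota (n : ℕ) : ℝ := deltaIntegral n 1 (fun _ => 1)

/-! ### Melonic graphs -/

/-- A melonic dressing of an internal line: the sequence of the one-particle irreducible melonic
two-point graphs inserted along it.  A one-particle irreducible melonic two-point graph consists of
its external vertex, of some colour `c`, and of one loop line hooked to that vertex, which is
dressed in turn; so `insert c loop rest` is the dressing that starts with the insertion of colour
`c` whose loop line carries the dressing `loop`, followed along the line by `rest`. -/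
inductive Dressing (d : ℕ) : Type
  | bare : Dressing d
  | insert (c : Fin d) (loop rest : Dressing d) : Dressing d

/-- The total number of vertices of a dressing. -/
def Dressing.size {d : ℕ} : Dressing d → ℕ
  | .bare => 0
  | .insert _ loop rest => loop.size + rest.size + 1

/-- The number of two-point graphs inserted on the line itself: the line then consists of
`len + 1` propagators. -/
def Dressing.len {d : ℕ} : Dressing d → ℕ
  | .bare => 0
  | .insert _ _ rest => rest.len + 1

open Classical in
/-- The finite set of the dressings with a given number of vertices. -/
def Dressing.ofSize (d : ℕ) : ℕ → Finset (Dressing d)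
  | 0 => {.bare}
  | k + 1 =>
    (Finset.HasAntidiagonal.antidiagonal k).attach.biUnion fun ij =>
      have _h1 := Finset.HasAntidiagonal.antidiagonal.fst_le ij.2
      have _h2 := Finset.HasAntidiagonal.antidiagonal.snd_le ij.2
      ((Finset.univ : Finset (Fin d)) ×ˢ Dressing.ofSize d ij.1.1 ×ˢ Dressing.ofSize d ij.1.2).image
        fun x => Dressing.insert x.1 x.2.1 x.2.2
  termination_by k => k

theorem Dressing.mem_ofSize {d : ℕ} (D : Dressing d) (k : ℕ) :
    D ∈ Dressing.ofSize d k ↔ D.size = k := by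
  induction D generalizing k with
  | bare =>
    cases k with
    | zero => simp [Dressing.ofSize, Dressing.size]
    | succ k => simp [Dressing.ofSize, Dressing.size]
  | insert c loop rest ih1 ih2 =>
    cases k with
    | zero => simp [Dressing.ofSize, Dressing.size]
    | succ k =>
      simp only [Dressing.ofSize, Dressing.size, Finset.mem_biUnion, Finset.mem_attach,
        Finset.mem_image, Finset.mem_product, Finset.mem_univ, true_and, Subtype.exists,
        Prod.exists, Finset.HasAntidiagonal.mem_antidiagonal, Dressing.insert.injEq]
      constructor
      · rintro ⟨a, b, hab, c', l, r, ⟨hl, hr⟩, rfl, rfl, rfl⟩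
        rw [ih1] at hl
        rw [ih2] at hr
        omega
      · intro h
        exact ⟨loop.size, rest.size, by omega, c, loop, rest,
          ⟨(ih1 _).2 rfl, (ih2 _).2 rfl⟩, rfl, rfl, rfl⟩

/-! ### Amplitudes in the continuum -/

/-- The product of the amplitudes of the two-point graphs inserted on a line of momentum `q`
(without the propagators of that line).  The external momentum of an insertion of colour `c` is
the component `q c`, and its loop momentum has `c`-th component `q c`. -/
def insertions (n : ℕ) (Λ M : ℝ) : Dressing (n + 1) → (Fin (n + 1) → ℝ) → ℝ
  | .bare, _ => 1
  | .insert c loop rest, q =>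
    (∫ k : Fin n → ℝ, propagator n Λ M (c.insertNth (q c) k) ^ (loop.len + 1) *
        insertions n Λ M loop (c.insertNth (q c) k)) * insertions n Λ M rest q

/-- The amplitude, at external momentum `p`, of the two-point graph of colour `c` whose loop line
carries the dressing `D`. -/
def amplitude (n : ℕ) (Λ M : ℝ) (c : Fin (n + 1)) (D : Dressing (n + 1)) (p : ℝ) : ℝ :=
  ∫ k : Fin n → ℝ, propagator n Λ M (c.insertNth p k) ^ (D.len + 1) *
    insertions n Λ M D (c.insertNth p k)

/-- The boundary part of the derivative of an amplitude at `p = 0`: the derivative of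
`Θ ^ (len + 1)` is `(len + 1) * Θ ^ len * δ`, where `Θ` is evaluated at the origin. -/
def boundaryPart (n : ℕ) (Λ M : ℝ) (c : Fin (n + 1)) (D : Dressing (n + 1)) : ℝ :=
  (D.len + 1) * heaviside 0 ^ D.len *
    deltaIntegral n (Λ ^ (2 * eta n)) (fun k =>
      insertions n Λ M D (c.insertNth 0 k) / (kin n (c.insertNth 0 k) + M) ^ (D.len + 1))

/-- The derivative of `insertions` with respect to `|q c| ^ (2η)`, at a momentum `q` such that
`q c = 0`: Leibniz's rule, in which only the insertions of colour `c` depend on `q c`; the factor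
of such an insertion is the derivative of its amplitude at zero external momentum (see
`amplitudeSlope`). -/
def insertionsSlope (n : ℕ) (Λ M : ℝ) (c : Fin (n + 1)) :
    Dressing (n + 1) → (Fin (n + 1) → ℝ) → ℝ
  | .bare, _ => 0
  | .insert c' loop rest, q =>
    (if c' = c then
      (∫ k : Fin n → ℝ,
        (-(loop.len + 1) * propagator n Λ M (c.insertNth 0 k) ^ (loop.len + 1) /
            (kin n (c.insertNth 0 k : Fin (n + 1) → ℝ) + M) *
            insertions n Λ M loop (c.insertNth 0 k) +
          propagator n Λ M (c.insertNth 0 k) ^ (loop.len + 1) *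
            insertionsSlope n Λ M c loop (c.insertNth 0 k)))
        - boundaryPart n Λ M c loop
      else 0) * insertions n Λ M rest q +
    amplitude n Λ M c' loop (q c') * insertionsSlope n Λ M c rest q

/-- The derivative of `amplitude` with respect to `|p| ^ (2η)` at `p = 0` with the sharp regulator:
the bulk part (the derivative under the integral of the denominators `q ^ (2η) + M` of the
`len + 1` propagators and of the insertions), minus the boundary part. -/
def amplitudeSlope (n : ℕ) (Λ M : ℝ) (c : Fin (n + 1)) (D : Dressing (n + 1)) : ℝ :=
  (∫ k : Fin n → ℝ,
    (-(D.len + 1) * propagator n Λ M (c.insertNth 0 k) ^ (D.len + 1) /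
        (kin n (c.insertNth 0 k : Fin (n + 1) → ℝ) + M) * insertions n Λ M D (c.insertNth 0 k) +
      propagator n Λ M (c.insertNth 0 k) ^ (D.len + 1) *
        insertionsSlope n Λ M c D (c.insertNth 0 k)))
    - boundaryPart n Λ M c D

/-- The one-loop amplitude, at zero external momenta, with two lines of momentum `q`, `q 0 = 0`,
that carry the dressings `D₁` and `D₂`. -/
def bubbleAmplitude (n : ℕ) (Λ M : ℝ) (D₁ D₂ : Dressing (n + 1)) : ℝ :=
  ∫ k : Fin n → ℝ,
    (propagator n Λ M (Fin.insertNth 0 0 k) ^ (D₁.len + 1) *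
        insertions n Λ M D₁ (Fin.insertNth 0 0 k)) *
      (propagator n Λ M (Fin.insertNth 0 0 k) ^ (D₂.len + 1) *
        insertions n Λ M D₂ (Fin.insertNth 0 0 k))

/-! ### Perturbative expansions, as formal power series in the coupling

Every vertex has the weight `-2 * l`: a sign from the exponential, and two Wick contractions. -/

/-- `τ(0)`, for the colour `c`. -/
def tauSeries (n : ℕ) (Λ M : ℝ) (c : Fin (n + 1)) : PowerSeries ℝ :=
  PowerSeries.X * PowerSeries.mk fun k =>
    ∑ D ∈ Dressing.ofSize (n + 1) k, (-2) ^ (k + 1) * amplitude n Λ M c D 0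

/-- `τ'(0)`, the derivative with respect to `p ^ (2η)`, for the colour `0`. -/
def tauSlopeSeries (n : ℕ) (Λ M : ℝ) : PowerSeries ℝ :=
  PowerSeries.X * PowerSeries.mk fun k =>
    ∑ D ∈ Dressing.ofSize (n + 1) k, (-2) ^ (k + 1) * amplitudeSlope n Λ M 0 D

/-- The mass term `Γ⁽²⁾(0) = M - ∑ c, τ(0)`. -/
def twoPointSeries (n : ℕ) (Λ M : ℝ) : PowerSeries ℝ :=
  PowerSeries.C M - ∑ c : Fin (n + 1), tauSeries n Λ M c

/-- The field strength `∂Γ⁽²⁾/∂p₁^(2η) (0) = 1 - τ'(0)`. -/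
def fieldStrengthSeries (n : ℕ) (Λ M : ℝ) : PowerSeries ℝ := 1 - tauSlopeSeries n Λ M

/-- The loop `𝓛`: the integral over `q` with `q 0 = 0` of the squared melonic propagator. -/
def loopSeries (n : ℕ) (Λ M : ℝ) : PowerSeries ℝ :=
  PowerSeries.mk fun k => ∑ ab ∈ Finset.HasAntidiagonal.antidiagonal k,
    ∑ D₁ ∈ Dressing.ofSize (n + 1) ab.1, ∑ D₂ ∈ Dressing.ofSize (n + 1) ab.2,
      (-2) ^ k * bubbleAmplitude n Λ M D₁ D₂

/-- The zero-momenta one-particle irreducible melonic four-point function: the sum over `j` of the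
chains of `j + 1` vertices of the same colour, joined by `j` loops of two dressed lines.  (Chains
with `j ≥ k` do not contribute to the order `k`.) -/
def fourPointSeries (n : ℕ) (Λ M : ℝ) : PowerSeries ℝ :=
  PowerSeries.mk fun k => PowerSeries.coeff k
    (PowerSeries.C (4 : ℝ) * PowerSeries.X *
      ∑ j ∈ Finset.range (k + 1),
        (PowerSeries.C (-2 : ℝ) * PowerSeries.X * loopSeries n Λ M) ^ j)

/-- `f` is an analytic function on `U` which near the Gaussian points `l = 0`, `M > 0` of `U` is
the sum of the perturbative expansion `P`. -/
def IsResummation (U : Set (ℝ × ℝ × ℝ)) (P : ℝ → ℝ → PowerSeries ℝ) (f : ℝ × ℝ × ℝ → ℝ) : Prop :=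
  AnalyticOnNhd ℝ f U ∧
    ∀ Λ M : ℝ, 0 < M → (Λ, 0, M) ∈ U →
      ∀ᶠ l in 𝓝 (0 : ℝ), HasSum (fun k => PowerSeries.coeff k (P Λ M) * l ^ k) (f (Λ, l, M))

/-! ### Renormalization group -/

/-- The Callan-Symanzik equation
`(Λ ∂/∂Λ + β ∂/∂l + βm ∂/∂M - (N / 2) γ) f = 0` at the point `(Λ, l, M)`. -/
def CallanSymanzikAt (N : ℕ) (β βm γ : ℝ × ℝ × ℝ → ℝ) (f : ℝ × ℝ × ℝ → ℝ) (Λ l M : ℝ) : Prop :=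
  Λ * deriv (fun s => f (s, l, M)) Λ + β (Λ, l, M) * deriv (fun s => f (Λ, s, M)) l +
    βm (Λ, l, M) * deriv (fun s => f (Λ, l, s)) M - (N : ℝ) / 2 * γ (Λ, l, M) * f (Λ, l, M) = 0

/-- The dimensionless mass `M * Λ ^ (-2η)`. -/
def massBar (n : ℕ) (Λ M : ℝ) : ℝ := M / Λ ^ (2 * eta n)

/-- The β-function of the dimensionless mass: `Λ ^ (2η) * betaMassBar = βm - 2η M`. -/
def betaMassBar (n : ℕ) (βm : ℝ × ℝ × ℝ → ℝ) (Λ l M : ℝ) : ℝ :=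
  (βm (Λ, l, M) - 2 * eta n * M) / Λ ^ (2 * eta n)

/-- The region of the plane of the couplings `(l, massBar)` that is connected to the Gaussian fixed
point `(0, 0)` in the complement of the singular line `1 + massBar - 2 * l * ι(d) = 0`. -/
def gaussianRegion (n : ℕ) : Set (ℝ × ℝ) :=
  connectedComponentIn {x : ℝ × ℝ | 1 + x.2 - 2 * x.1 * iota n ≠ 0} (0, 0)

end MelonicTGFT

end

noncomputable section
namespace MelonicTGFT

/-! ### Generating series of dressings -/

/-! Everything follows from one algebraic relation between `γ⁽⁴⁾` and `Z_eff`. Write `G` for the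
dressed line, `T` for the sum over all colours of the insertions on it, `C` for the propagator and
`b = ι(d) / (1 + m̄^(2η))`. Cutting a line at its first insertion gives Dyson's equation `G = C + T
C G`. Differentiating the denominators and the insertions in the same recursion gives the bulk slope
`-G² Z_eff` (`genSeries_lineSlope`). `Z_eff` does not depend on the loop momentum, so integration
turns this into `-𝓛 Z_eff`. The sharp cut-off adds the boundary term, which only the bare loop feels
because `Θ(0) = 0`; it equals `b` by homogeneity of the volume of the sublevel sets of `kin`
(`deltaIntegral_inv`). Hence `Z_eff (1 + 2λ𝓛) = 1 - 2λ b` (`fieldStrengthSeries_mul`). The geometric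
series of chains gives `γ⁽⁴⁾ (1 + 2λ𝓛) = 4λ` (`fourPointSeries_mul`). Eliminating `𝓛` leaves `γ⁽⁴⁾
(1 - 2λ b) = 4λ Z_eff`. This identity of formal series passes to the sums near `λ = 0`, and by the
identity theorem to all of `U` once denominators are cleared (`fourPoint_mul_eq`). Along the
Callan–Symanzik vector field `γ⁽⁴⁾` scales with `2γ`, `Z_eff` with `γ`, and `m̄^(2η)` moves with
velocity `β_m̄`. Differentiating the relation along that field gives a linear equation for `β`
(`beta_eq_of_relation`). -/

/-- The generating series of a weight on dressings, where each vertex counts `-2 * X`. -/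
def genSeries {d : ℕ} (w : Dressing d → ℝ) : PowerSeries ℝ :=
  PowerSeries.mk fun k => ∑ D ∈ Dressing.ofSize d k, (-2) ^ k * w D

theorem Dressing.ofSize_zero (d : ℕ) : Dressing.ofSize d 0 = {.bare} := by
  simp [Dressing.ofSize]

/-- A non-bare dressing splits uniquely into colour, loop and rest, and the outer vertex accounts
for the shift by one in the size. -/
theorem Dressing.sum_ofSize_succ {d : ℕ} (w : Dressing d → ℝ) (k : ℕ) :
    ∑ D ∈ Dressing.ofSize d (k + 1), w D =
      ∑ ij ∈ Finset.HasAntidiagonal.antidiagonal k, ∑ c : Fin d,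
        ∑ D₁ ∈ Dressing.ofSize d ij.1, ∑ D₂ ∈ Dressing.ofSize d ij.2,
          w (.insert c D₁ D₂) := by
  have key : ∀ ij : ℕ × ℕ, (∑ c : Fin d,
        ∑ D₁ ∈ Dressing.ofSize d ij.1, ∑ D₂ ∈ Dressing.ofSize d ij.2, w (.insert c D₁ D₂)) =
      ∑ x ∈ (Finset.univ : Finset (Fin d)) ×ˢ Dressing.ofSize d ij.1 ×ˢ Dressing.ofSize d ij.2,
        w (.insert x.1 x.2.1 x.2.2) := by
    intro ij
    simp only [Finset.sum_product]
  simp only [key]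
  rw [Finset.sum_sigma']
  symm
  refine Finset.sum_bij (fun x _ => Dressing.insert x.2.1 x.2.2.1 x.2.2.2) ?_ ?_ ?_ ?_
  · rintro ⟨⟨i, j⟩, c, D₁, D₂⟩ h
    simp only [Finset.mem_sigma, Finset.mem_product, Finset.mem_univ, true_and,
      Dressing.mem_ofSize, Finset.HasAntidiagonal.mem_antidiagonal] at h ⊢
    simp only [Dressing.size]
    omega
  · rintro ⟨⟨i, j⟩, c, D₁, D₂⟩ h ⟨⟨i', j'⟩, c', D₁', D₂'⟩ h' heq
    simp only [Finset.mem_sigma, Finset.mem_product, Finset.mem_univ, true_and,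
      Dressing.mem_ofSize, Finset.HasAntidiagonal.mem_antidiagonal] at h h'
    simp only [Dressing.insert.injEq] at heq
    obtain ⟨rfl, rfl, rfl⟩ := heq
    obtain ⟨-, rfl, rfl⟩ := h
    obtain ⟨-, rfl, rfl⟩ := h'
    rfl
  · intro D hD
    rw [Dressing.mem_ofSize] at hD
    cases D with
    | bare => simp [Dressing.size] at hD
    | insert c D₁ D₂ =>
      refine ⟨⟨(D₁.size, D₂.size), c, D₁, D₂⟩, ?_, rfl⟩
      simp only [Dressing.size] at hD
      simp only [Finset.mem_sigma, Finset.mem_product, Finset.mem_univ,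
        Dressing.mem_ofSize, Finset.HasAntidiagonal.mem_antidiagonal, and_self, and_true]
      omega
  · intros
    rfl

theorem coeff_genSeries {d : ℕ} (w : Dressing d → ℝ) (k : ℕ) :
    PowerSeries.coeff k (genSeries w) = ∑ D ∈ Dressing.ofSize d k, (-2) ^ k * w D :=
  PowerSeries.coeff_mk _ _

theorem coeff_genSeries_mul {d : ℕ} (w₁ w₂ : Dressing d → ℝ) (k : ℕ) :
    PowerSeries.coeff k (genSeries w₁ * genSeries w₂) =
      ∑ ij ∈ Finset.HasAntidiagonal.antidiagonal k, ∑ D₁ ∈ Dressing.ofSize d ij.1,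
        ∑ D₂ ∈ Dressing.ofSize d ij.2, (-2) ^ k * (w₁ D₁ * w₂ D₂) := by
  rw [PowerSeries.coeff_mul]
  refine Finset.sum_congr rfl fun ij hij => ?_
  rw [coeff_genSeries, coeff_genSeries, Finset.sum_mul_sum]
  refine Finset.sum_congr rfl fun D₁ _ => Finset.sum_congr rfl fun D₂ _ => ?_
  rw [← Finset.HasAntidiagonal.mem_antidiagonal.1 hij, pow_add]
  ring

theorem genSeries_add {d : ℕ} (w₁ w₂ : Dressing d → ℝ) :
    genSeries (fun D => w₁ D + w₂ D) = genSeries w₁ + genSeries w₂ := by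
  ext k
  simp only [map_add, coeff_genSeries, mul_add, Finset.sum_add_distrib]

theorem genSeries_const_mul {d : ℕ} (a : ℝ) (w : Dressing d → ℝ) :
    genSeries (fun D => a * w D) = PowerSeries.C a * genSeries w := by
  ext k
  simp only [PowerSeries.coeff_C_mul, coeff_genSeries, Finset.mul_sum]
  exact Finset.sum_congr rfl fun D _ => by ring

/-- The functional equation of the generating series of a weight that is defined by recursion along
the line. -/
theorem genSeries_of_insert {d : ℕ} (w : Dressing d → ℝ) (f₁ f₂ : Fin d → Dressing d → ℝ)
    (g₁ g₂ : Dressing d → ℝ)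
    (h : ∀ c D₁ D₂, w (.insert c D₁ D₂) = f₁ c D₁ * g₁ D₂ + f₂ c D₁ * g₂ D₂) :
    genSeries w = PowerSeries.C (w .bare) +
      (PowerSeries.C (-2) * PowerSeries.X * ∑ c, genSeries (f₁ c)) * genSeries g₁ +
      (PowerSeries.C (-2) * PowerSeries.X * ∑ c, genSeries (f₂ c)) * genSeries g₂ := by
  ext k
  cases k with
  | zero =>
    simp [coeff_genSeries, Dressing.ofSize_zero, mul_assoc, PowerSeries.coeff_zero_eq_constantCoeff]
  | succ k =>
    simp only [map_add, mul_assoc, PowerSeries.coeff_C_mul, PowerSeries.coeff_succ_X_mul,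
      Finset.sum_mul, map_sum, coeff_genSeries_mul]
    rw [coeff_genSeries, ← Finset.mul_sum, Dressing.sum_ofSize_succ, PowerSeries.coeff_C,
      if_neg k.succ_ne_zero, zero_add, Finset.sum_comm, ← mul_add, ← Finset.sum_add_distrib,
      pow_succ', mul_assoc, Finset.mul_sum]
    congr 1
    refine Finset.sum_congr rfl fun c _ => ?_
    rw [← Finset.sum_add_distrib, Finset.mul_sum]
    refine Finset.sum_congr rfl fun ij _ => ?_
    rw [← Finset.sum_add_distrib, Finset.mul_sum]
    refine Finset.sum_congr rfl fun D₁ _ => ?_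
    rw [← Finset.sum_add_distrib, Finset.mul_sum]
    refine Finset.sum_congr rfl fun D₂ _ => ?_
    rw [h]
    ring

/-! ### The dressed line and its slope -/

/-- The value of a dressed line of momentum `q`. -/
def lineWeight (n : ℕ) (Λ M : ℝ) (q : Fin (n + 1) → ℝ) (D : Dressing (n + 1)) : ℝ :=
  propagator n Λ M q ^ (D.len + 1) * insertions n Λ M D q

/-- The bulk part of the derivative of a dressed line with respect to `|q c| ^ (2η)`. -/
def lineSlope (n : ℕ) (Λ M : ℝ) (c : Fin (n + 1)) (q : Fin (n + 1) → ℝ)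
    (D : Dressing (n + 1)) : ℝ :=
  -(D.len + 1) * propagator n Λ M q ^ (D.len + 1) / (kin n q + M) * insertions n Λ M D q +
    propagator n Λ M q ^ (D.len + 1) * insertionsSlope n Λ M c D q

theorem insertions_insert (n : ℕ) (Λ M : ℝ) (c : Fin (n + 1)) (D₁ D₂ : Dressing (n + 1))
    (q : Fin (n + 1) → ℝ) :
    insertions n Λ M (.insert c D₁ D₂) q =
      amplitude n Λ M c D₁ (q c) * insertions n Λ M D₂ q := rfl

theorem insertionsSlope_insert (n : ℕ) (Λ M : ℝ) (c c' : Fin (n + 1)) (D₁ D₂ : Dressing (n + 1))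
    (q : Fin (n + 1) → ℝ) :
    insertionsSlope n Λ M c (.insert c' D₁ D₂) q =
      (if c' = c then amplitudeSlope n Λ M c D₁ else 0) * insertions n Λ M D₂ q +
        amplitude n Λ M c' D₁ (q c') * insertionsSlope n Λ M c D₂ q := rfl

/-- This is `Θ² = Θ`: differentiating the denominator of a propagator inserts a second propagator.
It holds even where the denominator vanishes, since division by zero gives zero. -/
theorem propagator_div (n : ℕ) (Λ M : ℝ) (q : Fin (n + 1) → ℝ) :
    propagator n Λ M q / (kin n q + M) = propagator n Λ M q * propagator n Λ M q := by
  unfold propagator heaviside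
  split_ifs <;> simp [div_eq_mul_inv]

theorem tauSlopeSeries_eq (n : ℕ) (Λ M : ℝ) :
    tauSlopeSeries n Λ M =
      PowerSeries.C (-2) * PowerSeries.X * genSeries (amplitudeSlope n Λ M 0) := by
  ext k
  unfold tauSlopeSeries
  cases k with
  | zero => simp [mul_assoc, PowerSeries.coeff_zero_eq_constantCoeff]
  | succ k =>
    rw [mul_assoc, PowerSeries.coeff_C_mul, PowerSeries.coeff_succ_X_mul,
      PowerSeries.coeff_succ_X_mul, coeff_genSeries, PowerSeries.coeff_mk, Finset.mul_sum]
    exact Finset.sum_congr rfl fun D _ => by ring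

/-- Dyson's equation: the slope of the dressed line is minus its square, times the field
strength. -/
theorem genSeries_lineSlope (n : ℕ) (Λ M : ℝ) (q : Fin (n + 1) → ℝ) :
    genSeries (lineSlope n Λ M 0 q) =
      -(genSeries (lineWeight n Λ M q) * genSeries (lineWeight n Λ M q) *
        fieldStrengthSeries n Λ M) := by
  set P := propagator n Λ M q with hP
  set T : PowerSeries ℝ := PowerSeries.C (-2) * PowerSeries.X *
    ∑ c, genSeries (fun D => amplitude n Λ M c D (q c)) with hT
  set G := genSeries (lineWeight n Λ M q) with hG
  have hGeq : G = PowerSeries.C P + T * (PowerSeries.C P * G) := by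
    have := genSeries_of_insert (lineWeight n Λ M q)
      (fun c D => amplitude n Λ M c D (q c)) (fun _ _ => 0)
      (fun D => P * lineWeight n Λ M q D) (fun _ => 0)
      (fun c D₁ D₂ => by
        simp only [lineWeight, Dressing.len, insertions_insert, ← hP]
        ring)
    rw [genSeries_const_mul, ← hT] at this
    have h0 : genSeries (fun _ : Dressing (n + 1) => (0 : ℝ)) = 0 := by
      ext k
      simp [coeff_genSeries]
    rw [h0, mul_zero, add_zero] at this
    simpa [lineWeight, Dressing.len, insertions] using this
  have hHeq : genSeries (lineSlope n Λ M 0 q) = -(PowerSeries.C P * G) +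
      T * (PowerSeries.C P * genSeries (lineSlope n Λ M 0 q)) +
      tauSlopeSeries n Λ M * (PowerSeries.C P * G) := by
    -- The line after its first insertion has one propagator fewer. Its missing derivative is the
    -- term with `-P * (P * lineWeight)`; the last term differentiates the first insertion itself,
    -- which depends on the slope variable only if its colour is `0`.
    have hstep : ∀ c D₁ D₂, lineSlope n Λ M 0 q (.insert c D₁ D₂) =
        amplitude n Λ M c D₁ (q c) *
          (P * lineSlope n Λ M 0 q D₂ + -P * (P * lineWeight n Λ M q D₂)) +
        (if c = 0 then amplitudeSlope n Λ M 0 D₁ else 0) * (P * lineWeight n Λ M q D₂) := by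
      intro c D₁ D₂
      simp only [lineSlope, lineWeight, Dressing.len, insertions_insert, insertionsSlope_insert,
        ← hP]
      have hdiv : ∀ a : ℕ, P ^ (a + 1) / (kin n q + M) = P ^ (a + 2) := by
        intro a
        rw [pow_succ, mul_div_assoc, propagator_div]
        ring
      rw [mul_div_assoc, mul_div_assoc, hdiv, hdiv]
      push_cast
      ring
    have := genSeries_of_insert _ _ _ _ _ hstep
    have hsel : ∑ c : Fin (n + 1), genSeries
        (fun D => if c = 0 then amplitudeSlope n Λ M 0 D else 0) =
        genSeries (amplitudeSlope n Λ M 0) := by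
      rw [Finset.sum_eq_single 0]
      · simp
      · intro c _ hc
        ext k
        simp [coeff_genSeries, hc]
      · simp
    rw [hsel, ← tauSlopeSeries_eq, genSeries_add, genSeries_const_mul, genSeries_const_mul,
      genSeries_const_mul, ← hT] at this
    have hb : lineSlope n Λ M 0 q .bare = -(P * P) := by
      simp only [lineSlope, Dressing.len, insertions, insertionsSlope, ← hP]
      simp [neg_div, hP, propagator_div]
    rw [hb] at this
    have h2 : PowerSeries.C (-(P * P)) = -(PowerSeries.C P * PowerSeries.C P) := by simp
    have h3 : PowerSeries.C (-P) = -PowerSeries.C P := by simp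
    rw [← hG, h2, h3] at this
    -- Dyson's equation times `P` collapses `-P² - T P² G` to `-P G`.
    have h4 := congrArg (fun x => PowerSeries.C P * x) hGeq
    linear_combination this + h4
  -- `T` is divisible by `X`, so the constant coefficient is `1`; power series over a field form a
  -- domain, which permits cancellation.
  have hne : (1 - T * PowerSeries.C P : PowerSeries ℝ) ≠ 0 := by
    intro h
    have := congrArg PowerSeries.constantCoeff h
    simp [hT] at this
  apply mul_left_cancel₀ hne
  unfold fieldStrengthSeries
  linear_combination hHeq - G * (1 - tauSlopeSeries n Λ M) * (-1) * hGeq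

/-- The chains form a geometric series in `u = -2 X 𝓛`. Since `X` divides `u`, truncating it at `j ≤
k` does not change the coefficient of order `k`. -/
theorem fourPointSeries_mul (n : ℕ) (Λ M : ℝ) :
    fourPointSeries n Λ M * (1 + PowerSeries.C 2 * PowerSeries.X * loopSeries n Λ M) =
      PowerSeries.C 4 * PowerSeries.X := by
  set u : PowerSeries ℝ := PowerSeries.C (-2 : ℝ) * PowerSeries.X * loopSeries n Λ M with hu
  have hunit : IsUnit (1 - u) := by
    rw [PowerSeries.isUnit_iff_constantCoeff]
    simp [hu]
  obtain ⟨v, hv⟩ := hunit.exists_right_inv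
  have h4 : fourPointSeries n Λ M = PowerSeries.C 4 * PowerSeries.X * v := by
    ext k
    rw [fourPointSeries, PowerSeries.coeff_mk, ← hu]
    have hgeom : v = ∑ j ∈ Finset.range (k + 1), u ^ j + u ^ (k + 1) * v := by
      have := mul_neg_geom_sum u (k + 1)
      linear_combination (∑ j ∈ Finset.range (k + 1), u ^ j) * hv - v * this
    have hX : PowerSeries.X ^ (k + 1) ∣
        PowerSeries.C 4 * PowerSeries.X * v -
          PowerSeries.C 4 * PowerSeries.X * ∑ j ∈ Finset.range (k + 1), u ^ j := by
      refine ⟨PowerSeries.C 4 * PowerSeries.X *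
        ((PowerSeries.C (-2) * loopSeries n Λ M) ^ (k + 1) * v), ?_⟩
      have : u ^ (k + 1) = PowerSeries.X ^ (k + 1) *
          (PowerSeries.C (-2) * loopSeries n Λ M) ^ (k + 1) := by
        rw [← mul_pow, hu]
        ring
      rw [this] at hgeom
      linear_combination PowerSeries.C 4 * PowerSeries.X * hgeom
    have := PowerSeries.X_pow_dvd_iff.1 hX k (Nat.lt_succ_self k)
    rw [map_sub, sub_eq_zero] at this
    exact this.symm
  have h2 : (1 + PowerSeries.C 2 * PowerSeries.X * loopSeries n Λ M : PowerSeries ℝ) = 1 - u := by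
    have : (PowerSeries.C (-2 : ℝ)) = -PowerSeries.C 2 := by simp
    rw [hu, this]
    ring
  rw [h4, h2]
  linear_combination PowerSeries.C 4 * PowerSeries.X * hv

/-! ### Measurability and integrability of the amplitudes -/

theorem two_mul_eta_pos {n : ℕ} (hn : 0 < n) : 0 < 2 * eta n := by
  have : (0 : ℝ) < n := by exact_mod_cast hn
  unfold eta
  positivity

theorem kin_nonneg (n : ℕ) {k : ℕ} (q : Fin k → ℝ) : 0 ≤ kin n q :=
  Finset.sum_nonneg fun _ _ => Real.rpow_nonneg (abs_nonneg _) _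

theorem measurable_kin (n k : ℕ) : Measurable (kin n : (Fin k → ℝ) → ℝ) := by
  unfold kin
  fun_prop

theorem measurable_heaviside : Measurable heaviside :=
  Measurable.ite measurableSet_Ioi measurable_const measurable_const

theorem measurable_propagator (n : ℕ) (Λ M : ℝ) : Measurable (propagator n Λ M) :=
  (measurable_heaviside.comp (measurable_const.sub (measurable_kin n _))).div
    ((measurable_kin n _).add_const M)

theorem measurable_insertNth {n : ℕ} (c : Fin (n + 1)) :
    Measurable fun x : ℝ × (Fin n → ℝ) => (c.insertNth x.1 x.2 : Fin (n + 1) → ℝ) := by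
  refine measurable_pi_iff.2 fun i => ?_
  refine c.succAboveCases ?_ (fun j => ?_) i
  · simpa using measurable_fst
  · simpa [Function.comp_def] using
      (measurable_pi_apply j).comp (measurable_snd : Measurable (Prod.snd : ℝ × (Fin n → ℝ) → _))

theorem measurable_insertNth_right {n : ℕ} (c : Fin (n + 1)) (p : ℝ) :
    Measurable fun k : Fin n → ℝ => (c.insertNth p k : Fin (n + 1) → ℝ) :=
  (measurable_insertNth c).comp (measurable_const.prodMk measurable_id)

theorem kin_insertNth_zero {n : ℕ} (hn : 0 < n) (c : Fin (n + 1)) (k : Fin n → ℝ) :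
    kin n (c.insertNth 0 k : Fin (n + 1) → ℝ) = kin n k := by
  unfold kin
  rw [Fin.sum_univ_succAbove _ c]
  simp [Real.zero_rpow (two_mul_eta_pos hn).ne']

theorem abs_apply_le_of_kin_le {n m : ℕ} (hn : 0 < n) {Λ : ℝ} (hΛ : 0 < Λ) {q : Fin m → ℝ}
    (h : kin n q ≤ Λ ^ (2 * eta n)) (i : Fin m) : |q i| ≤ Λ := by
  have h1 : |q i| ^ (2 * eta n) ≤ Λ ^ (2 * eta n) :=
    (Finset.single_le_sum (f := fun i => |q i| ^ (2 * eta n))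
      (fun _ _ => Real.rpow_nonneg (abs_nonneg _) _) (Finset.mem_univ i)).trans h
  exact (Real.rpow_le_rpow_iff (abs_nonneg _) hΛ.le (two_mul_eta_pos hn)).1 h1

theorem abs_propagator_le (n : ℕ) (Λ : ℝ) {M : ℝ} (hM : 0 < M) (q : Fin (n + 1) → ℝ) :
    |propagator n Λ M q| ≤ M⁻¹ := by
  have hk := kin_nonneg n q
  unfold propagator heaviside
  split_ifs
  · rw [one_div, abs_of_pos (by positivity)]
    exact inv_anti₀ hM (by linarith)
  · simpa using hM.le

theorem propagator_insertNth_eq_zero {n : ℕ} (hn : 0 < n) {Λ : ℝ} (hΛ : 0 < Λ) (M : ℝ)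
    (c : Fin (n + 1)) (p : ℝ) {k : Fin n → ℝ} (hk : k ∉ Metric.closedBall (0 : Fin n → ℝ) Λ) :
    propagator n Λ M (c.insertNth p k) = 0 := by
  unfold propagator heaviside
  rw [if_neg, zero_div]
  intro h
  refine hk ?_
  rw [mem_closedBall_zero_iff, pi_norm_le_iff_of_nonneg hΛ.le]
  intro i
  have := abs_apply_le_of_kin_le hn hΛ (sub_pos.1 h).le (c.succAbove i)
  simpa using this

/-- A bounded measurable function of the momentum. -/
def IsBddMeasurable {α : Type*} [MeasurableSpace α] (g : α → ℝ) : Prop :=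
  Measurable g ∧ ∃ B, ∀ q, |g q| ≤ B

namespace IsBddMeasurable

variable {α : Type*} [MeasurableSpace α] {f g : α → ℝ}

theorem const (a : ℝ) : IsBddMeasurable fun _ : α => a :=
  ⟨measurable_const, |a|, fun _ => le_rfl⟩

theorem mul (hf : IsBddMeasurable f) (hg : IsBddMeasurable g) :
    IsBddMeasurable fun q => f q * g q := by
  obtain ⟨hfm, A, hA⟩ := hf
  obtain ⟨hgm, B, hB⟩ := hg
  refine ⟨hfm.mul hgm, A * B, fun q => ?_⟩
  rw [abs_mul]
  exact mul_le_mul (hA q) (hB q) (abs_nonneg _) ((abs_nonneg _).trans (hA q))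

theorem add (hf : IsBddMeasurable f) (hg : IsBddMeasurable g) :
    IsBddMeasurable fun q => f q + g q := by
  obtain ⟨hfm, A, hA⟩ := hf
  obtain ⟨hgm, B, hB⟩ := hg
  exact ⟨hfm.add hgm, A + B, fun q => (abs_add_le _ _).trans (add_le_add (hA q) (hB q))⟩

theorem pow (hf : IsBddMeasurable f) (m : ℕ) : IsBddMeasurable fun q => f q ^ m := by
  obtain ⟨hfm, A, hA⟩ := hf
  refine ⟨hfm.pow_const m, A ^ m, fun q => ?_⟩
  rw [abs_pow]
  exact pow_le_pow_left₀ (abs_nonneg _) (hA q) m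

theorem comp {β : Type*} [MeasurableSpace β] (hf : IsBddMeasurable f) {e : β → α}
    (he : Measurable e) : IsBddMeasurable fun q => f (e q) :=
  ⟨hf.1.comp he, hf.2.imp fun _ h q => h (e q)⟩

end IsBddMeasurable

theorem isBddMeasurable_propagator (n : ℕ) (Λ : ℝ) {M : ℝ} (hM : 0 < M) :
    IsBddMeasurable (propagator n Λ M) :=
  ⟨measurable_propagator n Λ M, M⁻¹, abs_propagator_le n Λ hM⟩

section

variable {n : ℕ} {Λ M : ℝ}

/-- The cut-off confines the loop momentum to a ball of radius `Λ` in the sup norm, and `M > 0`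
bounds the propagator there. One explicit propagator factor therefore suffices for integrability. -/
theorem integrable_propagator_mul (hn : 0 < n) (hΛ : 0 < Λ) (hM : 0 < M)
    {g : (Fin (n + 1) → ℝ) → ℝ} (hg : IsBddMeasurable g) (c : Fin (n + 1)) (p : ℝ) :
    Integrable fun k : Fin n → ℝ => propagator n Λ M (c.insertNth p k) * g (c.insertNth p k) := by
  obtain ⟨hm, B, hB⟩ := ((isBddMeasurable_propagator n Λ hM).mul hg).comp
    (measurable_insertNth_right c p)
  have h := Measure.integrableOn_of_bounded (μ := volume) (s := Metric.closedBall (0 : Fin n → ℝ) Λ)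
    (M := B) measure_closedBall_lt_top.ne hm.aestronglyMeasurable (ae_of_all _ hB)
  refine (integrableOn_iff_integrable_of_support_subset fun k hk => ?_).1 h
  by_contra hk'
  exact hk (by simp [propagator_insertNth_eq_zero hn hΛ M c p hk'])

theorem isBddMeasurable_integral (hn : 0 < n) (hΛ : 0 < Λ) (hM : 0 < M)
    {g : (Fin (n + 1) → ℝ) → ℝ} (hg : IsBddMeasurable g) (c : Fin (n + 1)) :
    IsBddMeasurable fun p : ℝ =>
      ∫ k : Fin n → ℝ, propagator n Λ M (c.insertNth p k) * g (c.insertNth p k) := by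
  have hpg := (isBddMeasurable_propagator n Λ hM).mul hg
  refine ⟨(StronglyMeasurable.integral_prod_right'
    (hpg.1.comp (measurable_insertNth c)).stronglyMeasurable).measurable, ?_⟩
  obtain ⟨B, hB⟩ := hpg.2
  refine ⟨B * volume.real (Metric.closedBall (0 : Fin n → ℝ) Λ), fun p => ?_⟩
  beta_reduce
  rw [← setIntegral_eq_integral_of_forall_compl_eq_zero
    (s := Metric.closedBall (0 : Fin n → ℝ) Λ) fun k hk => by
      simp [propagator_insertNth_eq_zero hn hΛ M c p hk]]
  rw [← Real.norm_eq_abs]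
  exact norm_setIntegral_le_of_norm_le_const measure_closedBall_lt_top fun k _ => hB _

theorem isBddMeasurable_amplitude_of (hn : 0 < n) (hΛ : 0 < Λ) (hM : 0 < M) (c : Fin (n + 1))
    {D : Dressing (n + 1)} (hD : IsBddMeasurable (insertions n Λ M D)) :
    IsBddMeasurable (amplitude n Λ M c D) := by
  have := isBddMeasurable_integral hn hΛ hM
    (((isBddMeasurable_propagator n Λ hM).pow D.len).mul hD) c
  convert this using 2 with p
  refine integral_congr_ae (ae_of_all _ fun k => ?_)
  -- One of the `len + 1` propagators is split off to supply the compact support.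
  simp only [pow_succ', mul_assoc]

theorem isBddMeasurable_insertions (hn : 0 < n) (hΛ : 0 < Λ) (hM : 0 < M)
    (D : Dressing (n + 1)) : IsBddMeasurable (insertions n Λ M D) := by
  induction D with
  | bare => exact .const 1
  | insert c D₁ D₂ ih₁ ih₂ =>
    exact ((isBddMeasurable_amplitude_of hn hΛ hM c ih₁).comp (measurable_pi_apply c)).mul ih₂

theorem isBddMeasurable_amplitude (hn : 0 < n) (hΛ : 0 < Λ) (hM : 0 < M) (c : Fin (n + 1))
    (D : Dressing (n + 1)) : IsBddMeasurable (amplitude n Λ M c D) :=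
  isBddMeasurable_amplitude_of hn hΛ hM c (isBddMeasurable_insertions hn hΛ hM D)

theorem isBddMeasurable_insertionsSlope (hn : 0 < n) (hΛ : 0 < Λ) (hM : 0 < M)
    (c : Fin (n + 1)) (D : Dressing (n + 1)) : IsBddMeasurable (insertionsSlope n Λ M c D) := by
  induction D with
  | bare => exact .const 0
  | insert c' D₁ D₂ _ ih₂ =>
    exact ((IsBddMeasurable.const _).mul (isBddMeasurable_insertions hn hΛ hM D₂)).add
      (((isBddMeasurable_amplitude hn hΛ hM c' D₁).comp (measurable_pi_apply c')).mul ih₂)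

theorem integrable_lineWeight_mul (hn : 0 < n) (hΛ : 0 < Λ) (hM : 0 < M) (c : Fin (n + 1))
    (p : ℝ) (D₁ D₂ : Dressing (n + 1)) :
    Integrable fun k : Fin n → ℝ => lineWeight n Λ M (c.insertNth p k) D₁ *
      lineWeight n Λ M (c.insertNth p k) D₂ := by
  have hP := isBddMeasurable_propagator n Λ hM
  have := integrable_propagator_mul hn hΛ hM
    ((hP.pow (D₁.len + D₂.len + 1)).mul ((isBddMeasurable_insertions hn hΛ hM D₁).mul
      (isBddMeasurable_insertions hn hΛ hM D₂))) c p
  refine this.congr (ae_of_all _ fun k => ?_)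
  simp only [lineWeight]
  ring

theorem integrable_lineSlope (hn : 0 < n) (hΛ : 0 < Λ) (hM : 0 < M) (c : Fin (n + 1))
    (p : ℝ) (D : Dressing (n + 1)) :
    Integrable fun k : Fin n → ℝ => lineSlope n Λ M c (c.insertNth p k) D := by
  have hP := isBddMeasurable_propagator n Λ hM
  have := integrable_propagator_mul hn hΛ hM
    ((((IsBddMeasurable.const (-((D.len : ℝ) + 1))).mul (hP.pow (D.len + 1))).mul
      (isBddMeasurable_insertions hn hΛ hM D)).add
      ((hP.pow D.len).mul (isBddMeasurable_insertionsSlope hn hΛ hM c D))) c p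
  refine this.congr (ae_of_all _ fun k => ?_)
  simp only [lineSlope]
  have h := propagator_div n Λ M (c.insertNth p k)
  rw [mul_div_assoc, pow_succ, mul_div_assoc, h]
  ring

end

/-! ### The boundary contribution -/

-- Rescaling momenta by `ρ ^ (1 / (2η))` multiplies volume by `ρ ^ (n / (2η))`. The exponent is
-- exactly `2` because `2η = n / 2`.
open scoped Pointwise in
theorem measureReal_kin_le {n : ℕ} (hn : 0 < n) {ρ : ℝ} (hρ : 0 < ρ) :
    volume.real {k : Fin n → ℝ | kin n k ≤ ρ} =
      ρ ^ 2 * volume.real {k : Fin n → ℝ | kin n k ≤ 1} := by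
  have hη := two_mul_eta_pos hn
  set a := ρ ^ (2 * eta n)⁻¹ with ha
  have ha0 : 0 < a := Real.rpow_pos_of_pos hρ _
  have haη : a ^ (2 * eta n) = ρ := Real.rpow_inv_rpow hρ.le hη.ne'
  have hkin : ∀ k : Fin n → ℝ, kin n (a⁻¹ • k) = ρ⁻¹ * kin n k := by
    intro k
    simp only [kin, Pi.smul_apply, smul_eq_mul, Finset.mul_sum, abs_mul, abs_of_pos (inv_pos.2 ha0)]
    refine Finset.sum_congr rfl fun i _ => ?_
    rw [Real.mul_rpow (inv_pos.2 ha0).le (abs_nonneg _), Real.inv_rpow ha0.le, haη]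
  have hset : {k : Fin n → ℝ | kin n k ≤ ρ} = a • {k : Fin n → ℝ | kin n k ≤ 1} := by
    ext k
    rw [Set.mem_smul_set_iff_inv_smul_mem₀ ha0.ne', Set.mem_ofPred_eq, Set.mem_ofPred_eq, hkin,
      inv_mul_le_iff₀ hρ, mul_one]
  have hpow : a ^ n = ρ ^ 2 := by
    rw [ha, ← Real.rpow_natCast, ← Real.rpow_mul hρ.le, ← Real.rpow_natCast]
    congr 1
    have : (n : ℝ) ≠ 0 := by exact_mod_cast hn.ne'
    unfold eta
    push_cast
    field_simp
    norm_num
  rw [hset, measureReal_def, Measure.addHaar_smul, Module.finrank_fin_fun, hpow, ENNReal.toReal_mul,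
    ENNReal.toReal_ofReal (abs_nonneg _), abs_of_nonneg (by positivity), measureReal_def]

theorem hasDerivAt_measureReal_kin_le {n : ℕ} (hn : 0 < n) {r : ℝ} (hr : 0 < r) :
    HasDerivAt (fun ρ => volume.real {k : Fin n → ℝ | kin n k ≤ ρ})
      (2 * r * volume.real {k : Fin n → ℝ | kin n k ≤ 1}) r := by
  have h : HasDerivAt (fun ρ : ℝ => ρ ^ 2 * volume.real {k : Fin n → ℝ | kin n k ≤ 1})
      (2 * r * volume.real {k : Fin n → ℝ | kin n k ≤ 1}) r := by
    simpa using (hasDerivAt_pow 2 r).mul_const (volume.real {k : Fin n → ℝ | kin n k ≤ 1})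
  refine h.congr_of_eventuallyEq ?_
  filter_upwards [lt_mem_nhds hr] with ρ hρ
  exact measureReal_kin_le hn hρ

theorem iota_eq {n : ℕ} (hn : 0 < n) :
    iota n = 2 * volume.real {k : Fin n → ℝ | kin n k ≤ 1} := by
  unfold iota deltaIntegral
  have := (hasDerivAt_measureReal_kin_le hn one_pos).deriv
  simpa using this

/-- The derivative of the integral of `φ ∘ h` over the sublevel sets of `h`. -/
theorem hasDerivAt_setIntegral_sublevel {α : Type*} [MeasurableSpace α] {μ : Measure α}
    {h : α → ℝ} (hh : Measurable h) (hfin : ∀ ρ, μ {x | h x ≤ ρ} < ⊤) {φ : ℝ → ℝ}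
    {r g' : ℝ} (hφ : ContinuousAt φ r)
    (hint : ∀ ρ, IntegrableOn (fun x => φ (h x)) {x | h x ≤ ρ} μ)
    (hg : HasDerivAt (fun ρ => μ.real {x | h x ≤ ρ}) g' r) :
    HasDerivAt (fun ρ => ∫ x in {x | h x ≤ ρ}, φ (h x) ∂μ) (φ r * g') r := by
  have hmeas : ∀ ρ, MeasurableSet {x | h x ≤ ρ} := fun ρ => measurableSet_le hh measurable_const
  have hmono : ∀ {a b : ℝ}, a ≤ b → {x | h x ≤ a} ⊆ {x | h x ≤ b} :=
    fun hab x hx => le_trans hx hab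
  -- On the shell between two levels, `φ ∘ h` differs from `φ r` by at most `ε`, so the error is at
  -- most `ε` times the measure of the shell.
  have hdiff : ∀ {a b ε : ℝ}, a ≤ b → (∀ s ∈ Set.Icc a b, |φ s - φ r| ≤ ε) →
      |(∫ x in {x | h x ≤ b}, φ (h x) ∂μ) - (∫ x in {x | h x ≤ a}, φ (h x) ∂μ) -
        φ r * (μ.real {x | h x ≤ b} - μ.real {x | h x ≤ a})| ≤
      ε * |μ.real {x | h x ≤ b} - μ.real {x | h x ≤ a}| := by
    intro a b ε hab hε
    have hsub := hmono hab
    have hfd : μ ({x | h x ≤ b} \ {x | h x ≤ a}) < ⊤ :=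
      (measure_mono Set.sdiff_subset).trans_lt (hfin b)
    rw [← setIntegral_sdiff (hmeas a) (hint b) hsub, ← measureReal_sdiff hsub (hmeas a) (hfin b).ne,
      abs_of_nonneg measureReal_nonneg]
    have hc : φ r * μ.real ({x | h x ≤ b} \ {x | h x ≤ a}) =
        ∫ _ in {x | h x ≤ b} \ {x | h x ≤ a}, φ r ∂μ := by
      simp [mul_comm]
    rw [hc, ← integral_sub ((hint b).mono_set Set.sdiff_subset) (integrableOn_const hfd.ne)]
    rw [← Real.norm_eq_abs]
    exact norm_setIntegral_le_of_norm_le_const hfd fun x hx => hε _ ⟨(not_le.1 hx.2).le, hx.1⟩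
  -- The error is `o` of the increment of the measure, which is itself `O(ρ - r)` by
  -- differentiability.
  have ho : (fun ρ => (∫ x in {x | h x ≤ ρ}, φ (h x) ∂μ) - (∫ x in {x | h x ≤ r}, φ (h x) ∂μ) -
      φ r * (μ.real {x | h x ≤ ρ} - μ.real {x | h x ≤ r})) =o[𝓝 r] fun ρ => ρ - r := by
    refine Asymptotics.IsLittleO.trans_isBigO ?_ hg.isBigO_sub
    rw [Asymptotics.isLittleO_iff]
    intro ε hε
    obtain ⟨δ, hδ, hb⟩ := Metric.continuousAt_iff.1 hφ ε hε
    filter_upwards [Metric.ball_mem_nhds r hδ] with ρ hρ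
    rw [Metric.mem_ball, Real.dist_eq, abs_lt] at hρ
    have hb' : ∀ s, r - δ < s → s < r + δ → |φ s - φ r| ≤ ε := fun s h1 h2 =>
      (hb (by rw [Real.dist_eq, abs_lt]; constructor <;> linarith)).le
    rw [Real.norm_eq_abs, Real.norm_eq_abs]
    rcases le_total r ρ with hle | hle
    · exact hdiff hle fun s hs => hb' s (by linarith [hs.1]) (by linarith [hs.2])
    · have := hdiff hle fun s hs => hb' s (by linarith [hs.1]) (by linarith [hs.2])
      rw [← abs_neg, abs_sub_comm (μ.real {x | h x ≤ ρ})]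
      convert this using 2
      ring
  rw [hasDerivAt_iff_isLittleO]
  refine (ho.add ((hasDerivAt_iff_isLittleO.1 hg).const_mul_left (φ r))).congr_left fun ρ => ?_
  simp only [smul_eq_mul]
  ring

theorem volume_kin_le_lt_top {n : ℕ} (hn : 0 < n) (ρ : ℝ) :
    volume {k : Fin n → ℝ | kin n k ≤ ρ} < ⊤ := by
  have hη := two_mul_eta_pos hn
  set a := (max ρ 1) ^ (2 * eta n)⁻¹ with ha
  have hρ : 0 < max ρ 1 := lt_max_of_lt_right one_pos
  have ha0 : 0 < a := Real.rpow_pos_of_pos hρ _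
  refine (measure_mono (t := Metric.closedBall 0 a) fun k hk => ?_).trans_lt
    measure_closedBall_lt_top
  rw [mem_closedBall_zero_iff, pi_norm_le_iff_of_nonneg ha0.le]
  refine abs_apply_le_of_kin_le hn ha0 ?_
  rw [ha, Real.rpow_inv_rpow hρ.le hη.ne']
  exact hk.trans (le_max_left _ _)

/-- The integrand depends on `kin` alone and the volume has derivative `r ι` at `r`, so the value is
`r ι / (r + M)`. -/
theorem deltaIntegral_inv {n : ℕ} (hn : 0 < n) {M r : ℝ} (hM : 0 < M) (hr : 0 < r) :
    deltaIntegral n r (fun k => 1 / (kin n k + M)) = iota n / (1 + M / r) := by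
  have h := hasDerivAt_setIntegral_sublevel (μ := volume) (measurable_kin n n)
    (volume_kin_le_lt_top hn) (φ := fun s => 1 / (s + M)) (r := r)
    (ContinuousAt.div continuousAt_const (by fun_prop) (by positivity))
    (fun ρ => Measure.integrableOn_of_bounded (M := M⁻¹) (volume_kin_le_lt_top hn ρ).ne
      (measurable_const.div ((measurable_kin n n).add_const M)).aestronglyMeasurable
      (ae_of_all _ fun k => by
        have := kin_nonneg n k
        rw [Real.norm_eq_abs, one_div, abs_of_pos (by positivity)]
        exact inv_anti₀ hM (by linarith)))
    (hasDerivAt_measureReal_kin_le hn hr)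
  rw [deltaIntegral, h.deriv, iota_eq hn]
  field_simp

theorem boundaryPart_bare {n : ℕ} (hn : 0 < n) {Λ M : ℝ} (hΛ : 0 < Λ) (hM : 0 < M)
    (c : Fin (n + 1)) :
    boundaryPart n Λ M c .bare = iota n / (1 + massBar n Λ M) := by
  simp only [boundaryPart, Dressing.len, insertions, kin_insertNth_zero hn, massBar]
  rw [← deltaIntegral_inv hn hM (Real.rpow_pos_of_pos hΛ _)]
  simp

/-- At least one factor `Θ(0) = 0` survives; for the bare loop it is `0 ^ 0 = 1`. -/
theorem boundaryPart_insert (n : ℕ) (Λ M : ℝ) (c c' : Fin (n + 1)) (D₁ D₂ : Dressing (n + 1)) :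
    boundaryPart n Λ M c (.insert c' D₁ D₂) = 0 := by
  simp [boundaryPart, Dressing.len, heaviside]

/-! ### The identities between the perturbative series -/

theorem genSeries_boundaryPart {n : ℕ} (hn : 0 < n) {Λ M : ℝ} (hΛ : 0 < Λ) (hM : 0 < M)
    (c : Fin (n + 1)) :
    genSeries (boundaryPart n Λ M c) = PowerSeries.C (iota n / (1 + massBar n Λ M)) := by
  have := genSeries_of_insert (boundaryPart n Λ M c) (fun _ _ => 0) (fun _ _ => 0) (fun _ => 0)
    (fun _ => 0) (fun c' D₁ D₂ => by simp [boundaryPart_insert])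
  have h0 : genSeries (fun _ : Dressing (n + 1) => (0 : ℝ)) = 0 := by
    ext k
    simp [coeff_genSeries]
  rwa [h0, mul_zero, add_zero, add_zero, boundaryPart_bare hn hΛ hM] at this

/-- Dyson's slope identity is integrated order by order. Each coefficient is a finite sum of
integrable terms, and the field strength leaves the integral because it does not depend on the loop
momentum. -/
theorem genSeries_integral_lineSlope {n : ℕ} (hn : 0 < n) {Λ M : ℝ} (hΛ : 0 < Λ) (hM : 0 < M) :
    genSeries (fun D => ∫ k : Fin n → ℝ, lineSlope n Λ M 0 (Fin.insertNth 0 0 k) D) =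
      -(loopSeries n Λ M * fieldStrengthSeries n Λ M) := by
  have hloop : ∀ j, PowerSeries.coeff j (loopSeries n Λ M) = ∫ k : Fin n → ℝ,
      PowerSeries.coeff j (genSeries (lineWeight n Λ M (Fin.insertNth 0 0 k)) *
        genSeries (lineWeight n Λ M (Fin.insertNth 0 0 k))) := by
    intro j
    simp only [coeff_genSeries_mul]
    have hi := fun D₁ D₂ => (integrable_lineWeight_mul hn hΛ hM 0 0 D₁ D₂).const_mul ((-2) ^ j)
    rw [integral_finsetSum _ fun _ _ => integrable_finsetSum _ fun _ _ =>
      integrable_finsetSum _ fun _ _ => hi _ _]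
    rw [loopSeries, PowerSeries.coeff_mk]
    refine Finset.sum_congr rfl fun ab _ => ?_
    rw [integral_finsetSum _ fun _ _ => integrable_finsetSum _ fun _ _ => hi _ _]
    refine Finset.sum_congr rfl fun D₁ _ => ?_
    rw [integral_finsetSum _ fun _ _ => hi _ _]
    refine Finset.sum_congr rfl fun D₂ _ => ?_
    rw [integral_const_mul]
    rfl
  have hloop_int : ∀ j, Integrable fun k : Fin n → ℝ =>
      PowerSeries.coeff j (genSeries (lineWeight n Λ M (Fin.insertNth 0 0 k)) *
        genSeries (lineWeight n Λ M (Fin.insertNth 0 0 k))) := by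
    intro j
    simp only [coeff_genSeries_mul]
    exact integrable_finsetSum _ fun _ _ => integrable_finsetSum _ fun _ _ =>
      integrable_finsetSum _ fun _ _ =>
        (integrable_lineWeight_mul hn hΛ hM 0 0 _ _).const_mul _
  ext j
  have hl : PowerSeries.coeff j
      (genSeries fun D => ∫ k : Fin n → ℝ, lineSlope n Λ M 0 (Fin.insertNth 0 0 k) D) =
      ∫ k : Fin n → ℝ, PowerSeries.coeff j
        (genSeries (lineSlope n Λ M 0 (Fin.insertNth 0 0 k))) := by
    simp only [coeff_genSeries]
    rw [integral_finsetSum _ fun _ _ => (integrable_lineSlope hn hΛ hM 0 0 _).const_mul _]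
    exact Finset.sum_congr rfl fun D _ => (integral_const_mul _ _).symm
  rw [hl]
  simp only [genSeries_lineSlope, map_neg]
  rw [integral_neg, PowerSeries.coeff_mul]
  congr 1
  simp only [PowerSeries.coeff_mul (n := j) _ (fieldStrengthSeries n Λ M), hloop]
  rw [integral_finsetSum _ fun _ _ => (hloop_int _).mul_const _]
  exact Finset.sum_congr rfl fun D _ => integral_mul_const _ _

/-- The closed equation for the field strength. -/
theorem fieldStrengthSeries_mul {n : ℕ} (hn : 0 < n) {Λ M : ℝ} (hΛ : 0 < Λ) (hM : 0 < M) :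
    fieldStrengthSeries n Λ M * (1 + PowerSeries.C 2 * PowerSeries.X * loopSeries n Λ M) =
      1 - PowerSeries.C (2 * (iota n / (1 + massBar n Λ M))) * PowerSeries.X := by
  have hsplit : genSeries (amplitudeSlope n Λ M 0) =
      -(loopSeries n Λ M * fieldStrengthSeries n Λ M) -
        PowerSeries.C (iota n / (1 + massBar n Λ M)) := by
    rw [← genSeries_integral_lineSlope hn hΛ hM, ← genSeries_boundaryPart hn hΛ hM 0]
    ext k
    simp only [map_sub, coeff_genSeries, ← Finset.sum_sub_distrib, ← mul_sub]
    rfl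
  have hZ : fieldStrengthSeries n Λ M = 1 - tauSlopeSeries n Λ M := rfl
  rw [tauSlopeSeries_eq, hsplit] at hZ
  have h2 : (PowerSeries.C (-2 : ℝ)) = -PowerSeries.C 2 := by simp
  rw [h2] at hZ
  rw [map_mul]
  linear_combination hZ

theorem fourPointSeries_mul_sub {n : ℕ} (hn : 0 < n) {Λ M : ℝ} (hΛ : 0 < Λ) (hM : 0 < M) :
    fourPointSeries n Λ M *
        (1 - PowerSeries.C (2 * (iota n / (1 + massBar n Λ M))) * PowerSeries.X) =
      PowerSeries.C 4 * PowerSeries.X * fieldStrengthSeries n Λ M := by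
  rw [← fieldStrengthSeries_mul hn hΛ hM, ← fourPointSeries_mul n Λ M]
  ring

/-! ### The resummed identity -/

/-- Both multipliers are polynomials of degree at most one, so the relation is a one-step recursion
on coefficients, and an index shift of convergent sums replaces a Cauchy product. -/
theorem hasSum_mul_one_sub {P Q : PowerSeries ℝ} {a c l x y : ℝ}
    (h : P * (1 - PowerSeries.C c * PowerSeries.X) = PowerSeries.C a * PowerSeries.X * Q)
    (hP : HasSum (fun k => PowerSeries.coeff k P * l ^ k) x)
    (hQ : HasSum (fun k => PowerSeries.coeff k Q * l ^ k) y) :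
    x * (1 - c * l) = a * l * y := by
  have h0 : PowerSeries.coeff 0 P = 0 := by
    have := congrArg (PowerSeries.coeff 0) h
    simpa [PowerSeries.coeff_zero_eq_constantCoeff] using this
  have hs : ∀ k, PowerSeries.coeff (k + 1) P =
      c * PowerSeries.coeff k P + a * PowerSeries.coeff k Q := by
    intro k
    have h' : P = PowerSeries.C c * (PowerSeries.X * P) + PowerSeries.C a * (PowerSeries.X * Q) := by
      linear_combination h
    have := congrArg (PowerSeries.coeff (k + 1)) h'
    simpa only [map_add, PowerSeries.coeff_C_mul, PowerSeries.coeff_succ_X_mul] using this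
  have h1 := (hasSum_nat_add_iff' 1).2 hP
  have h2 := (hP.mul_left (c * l)).add (hQ.mul_left (a * l))
  have h3 := h1.unique (h2.congr_fun fun k => by
    simp only [hs]
    ring)
  simp [h0] at h3
  linarith

theorem analyticAt_massBar (n : ℕ) {x : ℝ × ℝ × ℝ} (hx : 0 < x.1) :
    AnalyticAt ℝ (fun x : ℝ × ℝ × ℝ => massBar n x.1 x.2.2) x := by
  unfold massBar
  exact (contDiffAt_snd.snd'.div (contDiffAt_fst.rpow_const_of_ne hx.ne')
    (Real.rpow_pos_of_pos hx _).ne').analyticAt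

/-- An analytic function on a connected open set `U` of parameters vanishes if it does so near
`l = 0` at all the Gaussian points of `U`. -/
theorem eqOn_zero_of_eventually_gaussian {U : Set (ℝ × ℝ × ℝ)} (hUo : IsOpen U)
    (hUc : IsPreconnected U) {Λ₀ M₀ : ℝ} (hM₀ : 0 < M₀) (hmem : (Λ₀, 0, M₀) ∈ U)
    {f : ℝ × ℝ × ℝ → ℝ} (hf : AnalyticOnNhd ℝ f U)
    (h : ∀ Λ M : ℝ, 0 < M → (Λ, 0, M) ∈ U → ∀ᶠ l in 𝓝 (0 : ℝ), f (Λ, l, M) = 0) :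
    Set.EqOn f 0 U := by
  refine hf.eqOn_zero_of_preconnected_of_eventuallyEq_zero hUc hmem ?_
  obtain ⟨ε, hε, hball⟩ := Metric.isOpen_iff.1 hUo _ hmem
  -- The box stays inside `U` and keeps `M > 0`. The neighbourhood of `l = 0` in `h` need not be
  -- uniform in `Λ` and `M`, so the one-variable identity theorem is first applied along each
  -- segment in `l`.
  have hδ : 0 < min ε M₀ := lt_min hε hM₀
  filter_upwards [Metric.ball_mem_nhds _ hδ] with ⟨Λ, l, M⟩ hx
  have hx' : |Λ - Λ₀| < min ε M₀ ∧ |l| < min ε M₀ ∧ |M - M₀| < min ε M₀ := by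
    simpa only [Metric.mem_ball, Prod.dist_eq, Real.dist_eq, sub_zero, max_lt_iff] using hx
  obtain ⟨h1, h2, h3⟩ := hx'
  have hin : ∀ s ∈ Metric.ball (0 : ℝ) (min ε M₀), (Λ, s, M) ∈ U := by
    intro s hs
    refine hball (Metric.ball_subset_ball (min_le_left ε M₀) ?_)
    rw [mem_ball_zero_iff, Real.norm_eq_abs] at hs
    simp only [Metric.mem_ball, Prod.dist_eq, Real.dist_eq, sub_zero, max_lt_iff]
    exact ⟨h1, hs, h3⟩
  have hMpos : 0 < M := by
    have := (abs_lt.1 (h3.trans_le (min_le_right _ _))).1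
    linarith
  have hl : AnalyticOnNhd ℝ (fun s => f (Λ, s, M)) (Metric.ball (0 : ℝ) (min ε M₀)) := fun s hs =>
    (hf _ (hin s hs)).comp (f := fun s : ℝ => (Λ, s, M)) (by fun_prop)
  have h0 : (0 : ℝ) ∈ Metric.ball (0 : ℝ) (min ε M₀) := Metric.mem_ball_self hδ
  refine hl.eqOn_zero_of_preconnected_of_eventuallyEq_zero (convex_ball _ _).isPreconnected h0
    (h Λ M hMpos (hin 0 h0)) (x := l) ?_
  rwa [mem_ball_zero_iff, Real.norm_eq_abs]

/-- The relation between the four-point function and the field strength. -/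
theorem fourPoint_mul_eq {n : ℕ} (hn : 0 < n) {U : Set (ℝ × ℝ × ℝ)} (hUo : IsOpen U)
    (hUc : IsPreconnected U) (hΛ : ∀ x ∈ U, 0 < x.1)
    (hGauss : ∃ Λ M : ℝ, 0 < M ∧ (Λ, 0, M) ∈ U) {Z Γ₄ : ℝ × ℝ × ℝ → ℝ}
    (hZ : IsResummation U (fieldStrengthSeries n) Z)
    (hΓ₄ : IsResummation U (fourPointSeries n) Γ₄) :
    ∀ x ∈ U, Γ₄ x * (1 + massBar n x.1 x.2.2 - 2 * iota n * x.2.1) =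
      4 * x.2.1 * Z x * (1 + massBar n x.1 x.2.2) := by
  obtain ⟨Λ₀, M₀, hM₀, hmem⟩ := hGauss
  have hf : AnalyticOnNhd ℝ (fun x => Γ₄ x * (1 + massBar n x.1 x.2.2 - 2 * iota n * x.2.1) -
      4 * x.2.1 * Z x * (1 + massBar n x.1 x.2.2)) U := by
    intro x hx
    have h1 := hΓ₄.1 x hx
    have h2 := hZ.1 x hx
    have h3 := analyticAt_massBar n (hΛ x hx)
    have h4 : AnalyticAt ℝ (fun x : ℝ × ℝ × ℝ => x.2.1) x := contDiffAt_fst.snd'.analyticAt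
    fun_prop
  intro x hx
  refine sub_eq_zero.1 (eqOn_zero_of_eventually_gaussian hUo hUc hM₀ hmem hf ?_ hx)
  intro Λ M hM hU
  have hΛ' : 0 < Λ := hΛ _ hU
  filter_upwards [hΓ₄.2 Λ M hM hU, hZ.2 Λ M hM hU] with l h4 hz
  have hw : 0 < 1 + massBar n Λ M := by
    have : 0 < Λ ^ (2 * eta n) := Real.rpow_pos_of_pos hΛ' _
    unfold massBar
    positivity
  have h := hasSum_mul_one_sub (fourPointSeries_mul_sub hn hΛ' hM) h4 hz
  field_simp at h
  linear_combination h

/-! ### The flow of the coupling -/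

/-- The derivative of the relation between the four-point function and the field strength along a
curve of parameters. -/
theorem hasDerivAt_relation {g z l w : ℝ → ℝ} {g' z' l' w' t b : ℝ}
    (hg : HasDerivAt g g' t) (hz : HasDerivAt z z' t) (hl : HasDerivAt l l' t)
    (hw : HasDerivAt w w' t)
    (h : ∀ᶠ s in 𝓝 t, g s * (1 + w s - b * l s) = 4 * l s * z s * (1 + w s)) :
    g' * (1 + w t - b * l t) + g t * (w' - b * l') =
      4 * (l' * z t * (1 + w t) + l t * z' * (1 + w t) + l t * z t * w') := by
  have h1 := hg.mul ((hw.const_add 1).sub (hl.const_mul b))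
  have h2 := ((hl.const_mul 4).mul hz).mul (hw.const_add 1)
  have := h1.unique (h2.congr_of_eventuallyEq h)
  simp only [Pi.mul_apply, Pi.sub_apply] at this
  linear_combination this

theorem beta_eq_of_relation {n : ℕ} {U : Set (ℝ × ℝ × ℝ)} (hUo : IsOpen U)
    (hΛ : ∀ x ∈ U, 0 < x.1) {Z Γ₄ : ℝ × ℝ × ℝ → ℝ}
    (hZ : AnalyticOnNhd ℝ Z U) (hΓ₄ : AnalyticOnNhd ℝ Γ₄ U)
    (hrel : ∀ x ∈ U, Γ₄ x * (1 + massBar n x.1 x.2.2 - 2 * iota n * x.2.1) =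
      4 * x.2.1 * Z x * (1 + massBar n x.1 x.2.2))
    {β βm γ : ℝ × ℝ × ℝ → ℝ} {Λ l M : ℝ} (hx : (Λ, l, M) ∈ U)
    (hCZ : CallanSymanzikAt 2 β βm γ Z Λ l M) (hC₄ : CallanSymanzikAt 4 β βm γ Γ₄ Λ l M)
    (hmass : massBar n Λ M ≠ -1)
    (hZx : Z (Λ, l, M) ≠ 0) :
    β (Λ, l, M) =
      γ (Λ, l, M) * l * (1 - 2 * l * iota n / (1 + massBar n Λ M)) +
        2 * l ^ 2 * iota n / (1 + massBar n Λ M) ^ 2 * betaMassBar n βm Λ l M := by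
  have hΛ0 : 0 < Λ := hΛ _ hx
  have hr0 : 0 < Λ ^ (2 * eta n) := Real.rpow_pos_of_pos hΛ0 _
  have hU : ∀ᶠ x in 𝓝 (Λ, l, M), x ∈ U := hUo.mem_nhds hx
  have hc1 : DifferentiableAt ℝ (fun s : ℝ => (s, l, M)) Λ := by fun_prop
  have hc2 : DifferentiableAt ℝ (fun s : ℝ => (Λ, s, M)) l := by fun_prop
  have hc3 : DifferentiableAt ℝ (fun s : ℝ => (Λ, l, s)) M := by fun_prop
  have dg := (hΓ₄ _ hx).differentiableAt
  have dz := (hZ _ hx).differentiableAt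
  have hw1 : HasDerivAt (fun s => massBar n s M) (-(2 * eta n * M) / (Λ * Λ ^ (2 * eta n))) Λ := by
    have h := (hasDerivAt_const Λ M).div (Real.hasDerivAt_rpow_const (p := 2 * eta n)
      (Or.inl hΛ0.ne')) hr0.ne'
    refine h.congr_deriv ?_
    rw [Real.rpow_sub_one hΛ0.ne']
    field_simp
    ring
  have hw3 : HasDerivAt (fun s => massBar n Λ s) (1 / Λ ^ (2 * eta n)) M :=
    (hasDerivAt_id M).div_const _
  have e1 := hasDerivAt_relation (b := 2 * iota n) (dg.comp Λ hc1).hasDerivAt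
    (dz.comp Λ hc1).hasDerivAt (hasDerivAt_const Λ l) hw1
    ((hc1.continuousAt.eventually hU).mono fun s h => hrel _ h)
  have e2 := hasDerivAt_relation (b := 2 * iota n) (dg.comp l hc2).hasDerivAt
    (dz.comp l hc2).hasDerivAt (hasDerivAt_id l) (hasDerivAt_const l (massBar n Λ M))
    ((hc2.continuousAt.eventually hU).mono fun s h => hrel _ h)
  have e3 := hasDerivAt_relation (b := 2 * iota n) (dg.comp M hc3).hasDerivAt
    (dz.comp M hc3).hasDerivAt (hasDerivAt_const M l) hw3
    ((hc3.continuousAt.eventually hU).mono fun s h => hrel _ h)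
  have e0 := hrel _ hx
  simp only [Function.comp_def, id_eq] at e0 e1 e2 e3
  unfold CallanSymanzikAt at hCZ hC₄
  -- The explicit `Λ` dependence of `m̄^(2η)` produces the `-2η M` in `β_m̄`.
  have hbm : betaMassBar n βm Λ l M = Λ * (-(2 * eta n * M) / (Λ * Λ ^ (2 * eta n))) +
      βm (Λ, l, M) * (1 / Λ ^ (2 * eta n)) := by
    unfold betaMassBar
    field_simp
    ring
  have hw : 1 + massBar n Λ M ≠ 0 := fun h => hmass (by linarith)
  push_cast at hCZ hC₄
  set W := massBar n Λ M
  set B := betaMassBar n βm Λ l M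
  set g := Γ₄ (Λ, l, M)
  set z := Z (Λ, l, M)
  set b := β (Λ, l, M)
  set m := βm (Λ, l, M)
  set c := γ (Λ, l, M)
  -- The relation is differentiated along the Callan–Symanzik field, with the derivatives of `g` and
  -- `z` replaced by `2 c g` and `c z`.
  have key : 2 * c * g * (1 + W - 2 * iota n * l) + g * (B - 2 * iota n * b) =
      4 * (b * z * (1 + W) + l * (c * z) * (1 + W) + l * z * B) := by
    rw [hbm]
    linear_combination Λ * e1 + b * e2 + m * e3 - (1 + W - 2 * iota n * l) * hC₄ +
      4 * l * (1 + W) * hCZ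
  -- Multiplying by `1 + W - 2lι` lets the relation eliminate `g`. The terms in `b` then combine to
  -- `(1 + W)²`, so only `z` and `1 + W` have to be cancelled.
  have hmul : 4 * z * (b * (1 + W) ^ 2) =
      4 * z * (c * l * (1 + W - 2 * l * iota n) * (1 + W) + 2 * l ^ 2 * iota n * B) := by
    linear_combination (-(1 + W - 2 * l * iota n)) * key +
      (2 * c * (1 + W - 2 * iota n * l) + (B - 2 * iota n * b)) * e0
  have hfin := mul_left_cancel₀ (mul_ne_zero four_ne_zero hZx) hmul
  field_simp
  linear_combination hfin

end MelonicTGFT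
end

theorem mainTheorem8 (n : ℕ) (hn : 3 ≤ n)
    (U : Set (ℝ × ℝ × ℝ)) (hUo : IsOpen U) (hUc : IsPreconnected U)
    (hΛ : ∀ x ∈ U, 0 < x.1)
    (hGauss : ∃ Λ M : ℝ, 0 < M ∧ (Λ, 0, M) ∈ U)
    (Γ₂ Z Γ₄ : ℝ × ℝ × ℝ → ℝ)
    (hΓ₂ : MelonicTGFT.IsResummation U (MelonicTGFT.twoPointSeries n) Γ₂)
    (hZ : MelonicTGFT.IsResummation U (MelonicTGFT.fieldStrengthSeries n) Z)
    (hΓ₄ : MelonicTGFT.IsResummation U (MelonicTGFT.fourPointSeries n) Γ₄)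
    (β βm γ : ℝ × ℝ × ℝ → ℝ)
    (hCS : ∀ Λ l M : ℝ, (Λ, l, M) ∈ U →
      MelonicTGFT.CallanSymanzikAt 2 β βm γ Γ₂ Λ l M ∧
      MelonicTGFT.CallanSymanzikAt 2 β βm γ Z Λ l M ∧
      MelonicTGFT.CallanSymanzikAt 4 β βm γ Γ₄ Λ l M)
    (Λ l M : ℝ) (hx : (Λ, l, M) ∈ U)
    (hregion : (l, MelonicTGFT.massBar n Λ M) ∈ MelonicTGFT.gaussianRegion n)
    (hmass : MelonicTGFT.massBar n Λ M ≠ -1)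
    (hZx : Z (Λ, l, M) ≠ 0) :
    β (Λ, l, M) =
      γ (Λ, l, M) * l * (1 - 2 * l * MelonicTGFT.iota n / (1 + MelonicTGFT.massBar n Λ M)) +
        2 * l ^ 2 * MelonicTGFT.iota n / (1 + MelonicTGFT.massBar n Λ M) ^ 2 *
          MelonicTGFT.betaMassBar n βm Λ l M :=
  MelonicTGFT.beta_eq_of_relation hUo hΛ hZ.1 hΓ₄.1
    (MelonicTGFT.fourPoint_mul_eq (by omega) hUo hUc hΛ hGauss hZ hΓ₄) hx (hCS Λ l M hx).2.1
    (hCS Λ l M hx).2.2 hmass hZx
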